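/- Let $X$ be a real or complex Banach space with a $1$-unconditional basis $(e_i)_{i\in I}$, $I$ countable (for instance $I=\mathbb N$; finite $I$ is allowed); that is, every $x\in X$ has a unique expansion $x=\sum_i x_ie_i$, this series converges unconditionally, and $\|\sum_{i\in F}\theta_i a_i e_i\|=\|\sum_{i\in F}a_ie_i\|$ for all finite $F\subset I$, all scalars $a_i$ and all signs $\theta_i=\pm1$. Let $\mathbb T$ be the set of scalars of modulus one, $B_X$ and $S_X$ the closed unit ball and the unit sphere of $X$, and, for $x^*\in S_{X^*}$ and $\varepsilon>0$, let $S(B_X,x^*,\varepsilon)=\{z\in B_X:\operatorname{Re}x^*(z)>\sup\operatorname{Re}x^*(B_X)-\varepsilon\}$. Then the following are equivalent. 1. $X$ has the alternative Daugavet property: every rank-one operator $T=f\otimes e$ on $X$ ($f\in X^*\setminus\{0\}$, $e\in X\setminus\{0\}$) satisfies $\max_{\theta\in\mathbb T}\|\mathrm{Id}+\theta T\|=1+\|T\|$. 2. $X$ is lush: for all $x,y\in S_X$ and every $\varepsilon>0$ there is $x^*\in S_{X^*}$ such that $x\in S:=S(B_X,x^*,\varepsilon)$ and $\operatorname{dist}(y,\overline{\mathrm{aconv}}(S))<\varepsilon$,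 where $\overline{\mathrm{aconv}}(S)$ is the closed convex hull of $\mathbb T S$. 3. $X$ has numerical index $1$: for every bounded linear operator $T:X\to X$, $\sup\{|x^*(Tx)|: x\in S_X,\ x^*\in S_{X^*},\ x^*(x)=1\}=\|T\|$ (the supremum being $0$ if $X=\{0\}$). -/

import Mathlib

open scoped Pointwise

noncomputable section

/-- A basis (with unconditionally convergent expansions) is `1`-unconditional if its unconditional
constant is `1`, that is, changing signs of coefficients does not change the norm. -/
def IsOneUnconditional {ι 𝕜 X : Type*} [RCLike 𝕜] [NormedAddCommGroup X] [NormedSpace 𝕜 X]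
    (b : UnconditionalSchauderBasis ι 𝕜 X) : Prop :=
  ∀ (s : Finset ι) (a : ι → 𝕜) (θ : ι → 𝕜), (∀ i, θ i = 1 ∨ θ i = -1) →
    ‖∑ i ∈ s, (θ i * a i) • b.basis i‖ = ‖∑ i ∈ s, a i • b.basis i‖

/-- The rank-one operator `f ⊗ e`, `x ↦ f x • e`, for nonzero `f` and `e`, satisfies
`max_{|θ| = 1} ‖Id + θ T‖ = 1 + ‖T‖`. -/
def AlternativeDaugavetProperty (𝕜 X : Type*) [RCLike 𝕜] [NormedAddCommGroup X]
    [NormedSpace 𝕜 X] : Prop :=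
  ∀ (f : StrongDual 𝕜 X) (e : X), f ≠ 0 → e ≠ 0 →
    IsGreatest
      ((fun θ : 𝕜 => ‖ContinuousLinearMap.id 𝕜 X + θ • f.smulRight e‖) '' Metric.sphere (0 : 𝕜) 1)
      (1 + ‖f.smulRight e‖)

/-- The numerical radius `v(T)` of a bounded operator. -/
def numericalRadius {𝕜 X : Type*} [RCLike 𝕜] [NormedAddCommGroup X] [NormedSpace 𝕜 X]
    (T : X →L[𝕜] X) : ℝ :=
  sSup {r : ℝ | ∃ (x : X) (f : StrongDual 𝕜 X), ‖x‖ = 1 ∧ ‖f‖ = 1 ∧ f x = 1 ∧ r = ‖f (T x)‖}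

/-- `X` has numerical index `1`: the numerical radius of every bounded operator is its norm. -/
def HasNumericalIndexOne (𝕜 X : Type*) [RCLike 𝕜] [NormedAddCommGroup X]
    [NormedSpace 𝕜 X] : Prop :=
  ∀ T : X →L[𝕜] X, numericalRadius T = ‖T‖

/-- The slice `S(B, f, α) = {x ∈ B : Re f(x) > sup Re f(B) - α}`. -/
def slice {𝕜 X : Type*} [RCLike 𝕜] [NormedAddCommGroup X] [NormedSpace 𝕜 X]
    (B : Set X) (f : StrongDual 𝕜 X) (α : ℝ) : Set X :=
  {x | x ∈ B ∧ sSup ((fun z => RCLike.re (f z)) '' B) - α < RCLike.re (f x)}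

/-- The closed absolutely convex hull of `A`: the closed convex hull of `𝕋 A`. -/
def closedAconv (𝕜 : Type*) {X : Type*} [RCLike 𝕜] [NormedAddCommGroup X] [NormedSpace 𝕜 X]
    [NormedSpace ℝ X] (A : Set X) : Set X :=
  closedConvexHull ℝ (Metric.sphere (0 : 𝕜) 1 • A)

/-- Lushness. -/
def IsLush (𝕜 X : Type*) [RCLike 𝕜] [NormedAddCommGroup X] [NormedSpace 𝕜 X]
    [NormedSpace ℝ X] : Prop :=
  ∀ x y : X, ‖x‖ = 1 → ‖y‖ = 1 → ∀ ε : ℝ, 0 < ε →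
    ∃ f : StrongDual 𝕜 X, ‖f‖ = 1 ∧
      x ∈ slice (Metric.closedBall (0 : X) 1) f ε ∧
      Metric.infDist y (closedAconv 𝕜 (slice (Metric.closedBall (0 : X) 1) f ε)) < ε

end

/-! ### Numerical radius; lushness implies numerical index one, which implies the alternative
Daugavet property. -/

section NumericalIndex

variable {𝕜 X : Type*} [RCLike 𝕜] [NormedAddCommGroup X] [NormedSpace 𝕜 X]

/-! Numerical index one gives the alternative Daugavet property by rotating scalars and maximising
over the compact set of unimodular θ.

From lushness to index one: take y nearly norming T and x = Ty/‖Ty‖. The functional f ∘ T is large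
at y, hence at some point u of the slice of f, where Re f(u) is nearly 1. So ‖Id + θT‖ = 1 + ‖T‖ for
some θ, and `opNorm_le_numericalRadius` gives v(T) = ‖T‖.

From the alternative Daugavet property to lushness: the property adds to any z ≠ 0 a vector w that
nearly norms a prescribed functional, with almost no loss in ‖z‖ + ‖w‖. Iterating over countably
many functionals and using weak* compactness puts all these w in one slice containing x. Its closed
absolutely convex hull K then nearly norms every finitely supported functional. The dual may be
nonseparable, but 1-unconditionality closes the gap: as 2P_A - Id is an isometry, a point of K at
which f ∘ P_A is nearly ‖f‖ is one at which f is nearly ‖f‖, so K is the unit ball. -/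

theorem re_apply_le_opNorm {f : StrongDual 𝕜 X} {x : X} (hx : ‖x‖ ≤ 1) :
    RCLike.re (f x) ≤ ‖f‖ :=
  (RCLike.re_le_norm _).trans (f.unit_le_opNorm x hx)

theorem exists_lt_re_apply_of_lt_opNorm (f : StrongDual 𝕜 X) {r : ℝ} (hr : r < ‖f‖) :
    ∃ x : X, ‖x‖ ≤ 1 ∧ r < RCLike.re (f x) := by
  obtain ⟨x, hx, hfx⟩ := f.exists_lt_apply_of_lt_opNorm hr
  obtain ⟨c, hc, hcx⟩ := RCLike.exists_norm_eq_mul_self (f x)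
  refine ⟨c • x, by rw [norm_smul, hc, one_mul]; exact hx.le, ?_⟩
  rwa [map_smul, smul_eq_mul, ← hcx, RCLike.ofReal_re]

theorem sSup_re_apply_closedBall (f : StrongDual 𝕜 X) :
    sSup ((fun z => RCLike.re (f z)) '' Metric.closedBall (0 : X) 1) = ‖f‖ := by
  refine csSup_eq_of_forall_le_of_forall_lt_exists_gt
    ((Metric.nonempty_closedBall.2 zero_le_one).image _) ?_ ?_
  · rintro _ ⟨z, hz, rfl⟩
    exact re_apply_le_opNorm (mem_closedBall_zero_iff.1 hz)
  · intro r hr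
    obtain ⟨x, hx, hfx⟩ := exists_lt_re_apply_of_lt_opNorm f hr
    exact ⟨_, ⟨x, mem_closedBall_zero_iff.2 hx, rfl⟩, hfx⟩

theorem mem_slice_closedBall {f : StrongDual 𝕜 X} {α : ℝ} {x : X} :
    x ∈ slice (Metric.closedBall (0 : X) 1) f α ↔ ‖x‖ ≤ 1 ∧ ‖f‖ - α < RCLike.re (f x) := by
  simp only [slice, Set.mem_ofPred_eq, sSup_re_apply_closedBall, mem_closedBall_zero_iff]

theorem norm_id_add_smul_le (T : X →L[𝕜] X) {θ : 𝕜} (hθ : ‖θ‖ = 1) :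
    ‖ContinuousLinearMap.id 𝕜 X + θ • T‖ ≤ 1 + ‖T‖ := by
  refine (norm_add_le _ _).trans (add_le_add ContinuousLinearMap.norm_id_le ?_)
  rw [norm_smul, hθ, one_mul]

theorem isGreatest_norm_id_add_smul (T : X →L[𝕜] X)
    (H : ∀ ε : ℝ, 0 < ε → ∃ θ : 𝕜, ‖θ‖ = 1 ∧
      1 + ‖T‖ - ε ≤ ‖ContinuousLinearMap.id 𝕜 X + θ • T‖) :
    IsGreatest ((fun θ : 𝕜 => ‖ContinuousLinearMap.id 𝕜 X + θ • T‖) '' Metric.sphere (0 : 𝕜) 1)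
      (1 + ‖T‖) := by
  have hub : 1 + ‖T‖ ∈ upperBounds
      ((fun θ : 𝕜 => ‖ContinuousLinearMap.id 𝕜 X + θ • T‖) '' Metric.sphere (0 : 𝕜) 1) := by
    rintro _ ⟨θ, hθ, rfl⟩
    exact norm_id_add_smul_le T (mem_sphere_zero_iff_norm.1 hθ)
  obtain ⟨θ₀, hθ₀, hmax⟩ := (isCompact_sphere (0 : 𝕜) 1).exists_isMaxOn
    ⟨1, by simp⟩
    (f := fun θ : 𝕜 => ‖ContinuousLinearMap.id 𝕜 X + θ • T‖)
    (by fun_prop)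
  refine ⟨⟨θ₀, hθ₀, le_antisymm (hub ⟨θ₀, hθ₀, rfl⟩) ?_⟩, hub⟩
  refine le_of_forall_pos_le_add fun ε hε => ?_
  obtain ⟨θ, hθ, h⟩ := H ε hε
  have := hmax (mem_sphere_zero_iff_norm.2 hθ)
  simp only [Set.mem_ofPred_eq] at this
  linarith

theorem exists_le_norm_id_add_smul (T : X →L[𝕜] X) {f : StrongDual 𝕜 X} {x : X}
    (hf : ‖f‖ ≤ 1) (hx : ‖x‖ ≤ 1) :
    ∃ θ : 𝕜, ‖θ‖ = 1 ∧
      RCLike.re (f x) + ‖f (T x)‖ ≤ ‖ContinuousLinearMap.id 𝕜 X + θ • T‖ := by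
  obtain ⟨c, hc, hcx⟩ := RCLike.exists_norm_eq_mul_self (f (T x))
  refine ⟨c, hc, ?_⟩
  calc RCLike.re (f x) + ‖f (T x)‖
      = RCLike.re (f ((ContinuousLinearMap.id 𝕜 X + c • T) x)) := by
        simp [← hcx]
    _ ≤ ‖f ((ContinuousLinearMap.id 𝕜 X + c • T) x)‖ := RCLike.re_le_norm _
    _ ≤ 1 * ‖(ContinuousLinearMap.id 𝕜 X + c • T) x‖ := f.le_of_opNorm_le hf _
    _ ≤ ‖ContinuousLinearMap.id 𝕜 X + c • T‖ := by
        rw [one_mul]; exact ContinuousLinearMap.unit_le_opNorm _ x hx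

theorem HasNumericalIndexOne.isGreatest_norm_id_add_smul (h : HasNumericalIndexOne 𝕜 X)
    {T : X →L[𝕜] X} (hT : T ≠ 0) :
    IsGreatest ((fun θ : 𝕜 => ‖ContinuousLinearMap.id 𝕜 X + θ • T‖) '' Metric.sphere (0 : 𝕜) 1)
      (1 + ‖T‖) := by
  refine _root_.isGreatest_norm_id_add_smul T fun ε hε => ?_
  have hv := h T
  rw [numericalRadius] at hv
  have hne : {r : ℝ | ∃ (x : X) (f : StrongDual 𝕜 X),
      ‖x‖ = 1 ∧ ‖f‖ = 1 ∧ f x = 1 ∧ r = ‖f (T x)‖}.Nonempty := by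
    -- The supremum of the empty set is 0, which would force T = 0.
    rw [Set.nonempty_iff_ne_empty]
    intro he
    rw [he, Real.sSup_empty] at hv
    exact hT (norm_eq_zero.1 hv.symm)
  obtain ⟨_, ⟨x, f, hx, hf, hfx, rfl⟩, hlt⟩ :=
    exists_lt_of_lt_csSup hne (hv.symm ▸ sub_lt_self ‖T‖ hε)
  obtain ⟨θ, hθ, hle⟩ := exists_le_norm_id_add_smul T hf.le hx.le
  refine ⟨θ, hθ, ?_⟩
  rw [hfx, RCLike.one_re] at hle
  linarith

theorem HasNumericalIndexOne.alternativeDaugavetProperty (h : HasNumericalIndexOne 𝕜 X) :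
    AlternativeDaugavetProperty 𝕜 X := by
  intro f e hf he
  refine h.isGreatest_norm_id_add_smul fun h0 => ?_
  obtain ⟨x, hx⟩ := DFunLike.ne_iff.1 hf
  have := DFunLike.congr_fun h0 x
  simp [he] at this
  exact hx this

theorem norm_apply_le_numericalRadius (T : X →L[𝕜] X) {x : X} {f : StrongDual 𝕜 X}
    (hx : ‖x‖ = 1) (hf : ‖f‖ = 1) (hfx : f x = 1) : ‖f (T x)‖ ≤ numericalRadius T := by
  refine le_csSup ⟨‖T‖, ?_⟩ ⟨x, f, hx, hf, hfx, rfl⟩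
  rintro _ ⟨y, g, hy, hg, -, rfl⟩
  calc ‖g (T y)‖ ≤ 1 * ‖T y‖ := g.le_of_opNorm_le hg.le _
    _ ≤ ‖T‖ := by rw [one_mul]; exact T.unit_le_opNorm y hy.le

theorem numericalRadius_le_opNorm (T : X →L[𝕜] X) : numericalRadius T ≤ ‖T‖ := by
  refine Real.sSup_le ?_ (norm_nonneg _)
  rintro _ ⟨y, g, hy, hg, -, rfl⟩
  calc ‖g (T y)‖ ≤ 1 * ‖T y‖ := g.le_of_opNorm_le hg.le _
    _ ≤ ‖T‖ := by rw [one_mul]; exact T.unit_le_opNorm y hy.le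

theorem numericalRadius_nonneg (T : X →L[𝕜] X) : 0 ≤ numericalRadius T := by
  refine Real.sSup_nonneg ?_
  rintro _ ⟨y, g, -, -, -, rfl⟩
  exact norm_nonneg _

/-- Dissipativity estimate: `1 - v(T)` bounds `Id - T` from below. -/
theorem one_sub_numericalRadius_mul_norm_le (T : X →L[𝕜] X) {s : 𝕜} (z : X) :
    (1 - ‖s‖ * numericalRadius T) * ‖z‖ ≤ ‖z - s • T z‖ := by
  rcases eq_or_ne z 0 with rfl | hz
  · simp
  have hz' : ‖z‖ ≠ 0 := norm_ne_zero_iff.2 hz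
  obtain ⟨f, hf, hfz⟩ := exists_dual_vector 𝕜 z hz'
  set x : X := ((‖z‖⁻¹ : ℝ) : 𝕜) • z with hxdef
  have hx : ‖x‖ = 1 := by
    rw [hxdef, norm_smul, RCLike.norm_ofReal, abs_of_nonneg (by positivity), inv_mul_cancel₀ hz']
  have hfx : f x = 1 := by
    rw [hxdef, map_smul, hfz, smul_eq_mul, ← RCLike.ofReal_mul, inv_mul_cancel₀ hz',
      RCLike.ofReal_one]
  have h1 := norm_apply_le_numericalRadius T hx hf hfx
  have h2 : ‖f (T x)‖ = ‖z‖⁻¹ * ‖f (T z)‖ := by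
    rw [hxdef, map_smul, map_smul, norm_smul, RCLike.norm_ofReal, abs_of_nonneg (by positivity)]
  have h3 : ‖f (T z)‖ ≤ numericalRadius T * ‖z‖ := by
    rw [h2] at h1
    rwa [inv_mul_le_iff₀ (by positivity), mul_comm] at h1
  have h4 : ‖f (z - s • T z)‖ ≤ 1 * ‖z - s • T z‖ := f.le_of_opNorm_le hf.le _
  have h5 : ‖f z‖ - ‖s‖ * ‖f (T z)‖ ≤ ‖f (z - s • T z)‖ := by
    rw [map_sub, map_smul, ← norm_smul]
    exact norm_sub_norm_le _ _
  have h6 : ‖f z‖ = ‖z‖ := by rw [hfz, RCLike.norm_ofReal, abs_norm]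
  nlinarith [mul_le_mul_of_nonneg_left h3 (norm_nonneg s)]

/-- By convexity the norm equality persists along s = tθ, whereas dissipativity gives ‖Id + sT‖ ≤ 1
+ t v(T) + O(t²). Letting t → 0 compares the slopes. -/
theorem opNorm_le_numericalRadius (T : X →L[𝕜] X) {θ : 𝕜} (hθ : ‖θ‖ = 1)
    (h : 1 + ‖T‖ ≤ ‖ContinuousLinearMap.id 𝕜 X + θ • T‖) : ‖T‖ ≤ numericalRadius T := by
  set μ := numericalRadius T
  have hμ0 : 0 ≤ μ := numericalRadius_nonneg T
  have hμT : μ ≤ ‖T‖ := numericalRadius_le_opNorm T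
  have key : ∀ t : ℝ, 0 < t → t ≤ 1 → t * ‖T‖ < 1 →
      ‖T‖ - μ ≤ t * (‖T‖ ^ 2 + μ * ‖T‖) := by
    intro t ht ht1 htT
    set s : 𝕜 := (t : 𝕜) * θ with hs
    have hsn : ‖s‖ = t := by rw [hs, norm_mul, hθ, mul_one, RCLike.norm_ofReal, abs_of_pos ht]
    have hlow : 1 + t * ‖T‖ ≤ ‖ContinuousLinearMap.id 𝕜 X + s • T‖ := by
      have he : ContinuousLinearMap.id 𝕜 X + θ • T =
          (ContinuousLinearMap.id 𝕜 X + s • T) + (((1 - t : ℝ) : 𝕜) * θ) • T := by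
        rw [add_assoc, ← add_smul, hs, ← add_mul, ← RCLike.ofReal_add]
        simp
      have hn : ‖(((1 - t : ℝ) : 𝕜) * θ) • T‖ = (1 - t) * ‖T‖ := by
        rw [norm_smul, norm_mul, hθ, mul_one, RCLike.norm_ofReal, abs_of_nonneg (by linarith)]
      have := norm_add_le (ContinuousLinearMap.id 𝕜 X + s • T) ((((1 - t : ℝ) : 𝕜) * θ) • T)
      rw [← he, hn] at this
      linarith
    have hpos : 0 < 1 - t * μ := by nlinarith
    have hup : ‖ContinuousLinearMap.id 𝕜 X + s • T‖ ≤ (1 + t ^ 2 * ‖T‖ ^ 2) / (1 - t * μ) := by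
      refine ContinuousLinearMap.opNorm_le_bound _ (by positivity) fun x => ?_
      rw [div_mul_eq_mul_div, le_div_iff₀ hpos]
      have h1 := one_sub_numericalRadius_mul_norm_le T (s := s) (x + s • T x)
      rw [hsn] at h1
      -- The factorisation (Id - sT)(Id + sT) = Id - s²T² removes the first-order term.
      have h2 : x + s • T x - s • T (x + s • T x) = x - (s * s) • T (T x) := by
        rw [map_add, map_smul, smul_add, smul_smul]; abel
      have h3 : ‖x - (s * s) • T (T x)‖ ≤ ‖x‖ + t ^ 2 * (‖T‖ * (‖T‖ * ‖x‖)) := by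
        refine (norm_sub_le _ _).trans ?_
        rw [norm_smul, norm_mul, hsn, ← pow_two]
        gcongr
        exact T.le_opNorm_of_le (T.le_opNorm x)
      rw [h2] at h1
      change ‖x + s • T x‖ * (1 - t * μ) ≤ _
      nlinarith
    have := hlow.trans hup
    rw [le_div_iff₀ hpos] at this
    have h7 : t * (‖T‖ - μ) ≤ t * (t * (‖T‖ ^ 2 + μ * ‖T‖)) := by nlinarith
    exact le_of_mul_le_mul_left h7 ht
  by_contra! hlt
  have hT0 : 0 < ‖T‖ := hμ0.trans_lt hlt
  set C := ‖T‖ ^ 2 + μ * ‖T‖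
  have hC : 0 < C := by positivity
  set t := min (min 1 (1 / (2 * ‖T‖))) ((‖T‖ - μ) / (2 * C))
  have ht : 0 < t := by
    refine lt_min (lt_min one_pos (by positivity)) (div_pos (by linarith) (by positivity))
  have ht1 : t ≤ 1 := (min_le_left _ _).trans (min_le_left _ _)
  have ht2 : t ≤ 1 / (2 * ‖T‖) := (min_le_left _ _).trans (min_le_right _ _)
  have ht3 : t ≤ (‖T‖ - μ) / (2 * C) := min_le_right _ _
  rw [le_div_iff₀ (by positivity)] at ht2 ht3
  have := key t ht ht1 (by linarith)
  linarith

theorem exists_norm_eq_one_lt_apply (T : X →L[𝕜] X) {r : ℝ} (hr0 : 0 ≤ r) (hr : r < ‖T‖) :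
    ∃ x : X, ‖x‖ = 1 ∧ r < ‖T x‖ := by
  obtain ⟨x, hx, hTx⟩ := T.exists_lt_apply_of_lt_opNorm hr
  have hx0 : x ≠ 0 := by
    rintro rfl
    rw [map_zero, norm_zero] at hTx
    exact absurd hTx hr0.not_gt
  have hpos : 0 < ‖x‖ := norm_pos_iff.2 hx0
  refine ⟨((‖x‖⁻¹ : ℝ) : 𝕜) • x, ?_, ?_⟩
  · rw [norm_smul, RCLike.norm_ofReal, abs_of_nonneg (by positivity), inv_mul_cancel₀ hpos.ne']
  · rw [map_smul, norm_smul, RCLike.norm_ofReal, abs_of_nonneg (by positivity)]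
    exact hTx.trans_le (le_mul_of_one_le_left (norm_nonneg _) ((one_le_inv₀ hpos).2 hx.le))

variable [NormedSpace ℝ X]

theorem subset_closedAconv (A : Set X) : A ⊆ closedAconv 𝕜 A := fun x hx =>
  subset_closedConvexHull (Set.mem_smul.2 ⟨1, by simp, x, hx, one_smul 𝕜 x⟩)

variable [IsScalarTower ℝ 𝕜 X]

theorem norm_apply_le_of_mem_closedAconv {A : Set X} (g : StrongDual 𝕜 X) {c : ℝ}
    (h : ∀ x ∈ A, ‖g x‖ ≤ c) {x : X} (hx : x ∈ closedAconv 𝕜 A) : ‖g x‖ ≤ c := by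
  have hconv : Convex ℝ {x : X | ‖g x‖ ≤ c} := by
    have : {x : X | ‖g x‖ ≤ c} = (g.restrictScalars ℝ).toLinearMap ⁻¹' Metric.closedBall 0 c := by
      ext; simp
    rw [this]
    exact (convex_closedBall (0 : 𝕜) c).linear_preimage _
  refine closedConvexHull_min (t := {x : X | ‖g x‖ ≤ c}) ?_ hconv
    (isClosed_le (by fun_prop) continuous_const) hx
  intro y hy
  obtain ⟨θ, hθ, z, hz, rfl⟩ := Set.mem_smul.1 hy
  simp only [Set.mem_ofPred_eq, map_smul, norm_smul, mem_sphere_zero_iff_norm.1 hθ, one_mul]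
  exact h z hz

theorem IsLush.hasNumericalIndexOne (h : IsLush 𝕜 X) : HasNumericalIndexOne 𝕜 X := by
  intro T
  refine le_antisymm (numericalRadius_le_opNorm T) ?_
  rcases eq_or_ne T 0 with rfl | hT
  · rw [norm_zero]; exact numericalRadius_nonneg _
  have hT0 : 0 < ‖T‖ := norm_pos_iff.2 hT
  obtain ⟨⟨θ, hθ, hθT⟩, -⟩ := isGreatest_norm_id_add_smul (𝕜 := 𝕜) T (fun δ hδ => by
    -- The bound on ‖f(Tu)‖ below loses at most (2‖T‖ + 2)ε, and Re f(u) > 1 - ε loses one more ε.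
    set ε := min (min (δ / (2 * ‖T‖ + 3)) ‖T‖) 1
    have hε : 0 < ε := lt_min (lt_min (by positivity) hT0) one_pos
    have hε1 : ε ≤ δ / (2 * ‖T‖ + 3) := (min_le_left _ _).trans (min_le_left _ _)
    have hε2 : ε ≤ ‖T‖ := (min_le_left _ _).trans (min_le_right _ _)
    have hε3 : ε ≤ 1 := min_le_right _ _
    rw [le_div_iff₀ (by positivity)] at hε1
    obtain ⟨y, hy, hTy⟩ := exists_norm_eq_one_lt_apply T (sub_nonneg.2 hε2) (sub_lt_self ‖T‖ hε)
    have hTy0 : 0 < ‖T y‖ := by linarith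
    set x : X := ((‖T y‖⁻¹ : ℝ) : 𝕜) • T y with hxdef
    have hx : ‖x‖ = 1 := by
      rw [hxdef, norm_smul, RCLike.norm_ofReal, abs_of_nonneg (by positivity),
        inv_mul_cancel₀ hTy0.ne']
    obtain ⟨f, hf, hxf, hyf⟩ := h x y hx hy ε hε
    rw [Metric.infDist_lt_iff ⟨x, subset_closedAconv _ hxf⟩] at hyf
    obtain ⟨v, hv, hyv⟩ := hyf
    rw [mem_slice_closedBall, hf] at hxf
    -- The bound ‖f ∘ T‖ ≤ c passes from the slice to its closed absolutely convex hull, hence to v.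
    -- The final ε makes the contradiction strict.
    obtain ⟨u, hu, hfu⟩ : ∃ u ∈ slice (Metric.closedBall (0 : X) 1) f ε,
        (‖T‖ - ε) * (1 - ε) - ‖T‖ * ε - ε < ‖f (T u)‖ := by
      by_contra! hcon
      have h1 := norm_apply_le_of_mem_closedAconv (f.comp T) hcon hv
      have h2 : ‖f (T y)‖ = ‖T y‖ * ‖f x‖ := by
        rw [hxdef, map_smul, norm_smul, RCLike.norm_ofReal, abs_of_nonneg (by positivity),
          ← mul_assoc, mul_inv_cancel₀ hTy0.ne', one_mul]
      have h3 : 1 - ε ≤ ‖f x‖ := hxf.2.le.trans (RCLike.re_le_norm _)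
      have h4 : (‖T‖ - ε) * (1 - ε) ≤ ‖T y‖ * ‖f x‖ :=
        mul_le_mul hTy.le h3 (by linarith) hTy0.le
      have h5 : ‖f (T y)‖ ≤ ‖f (T v)‖ + ‖f (T (y - v))‖ := by
        rw [map_sub, map_sub]
        have := norm_add_le (f (T v)) (f (T y) - f (T v))
        rwa [add_sub_cancel] at this
      have h6 : ‖f (T (y - v))‖ ≤ ‖T‖ * ε := by
        refine (f.le_of_opNorm_le hf.le _).trans ?_
        rw [one_mul]
        exact T.le_opNorm_of_le (by rw [← dist_eq_norm]; exact hyv.le)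
      change ‖f (T v)‖ ≤ _ at h1
      linarith
    rw [mem_slice_closedBall, hf] at hu
    obtain ⟨θ, hθ, hle⟩ := exists_le_norm_id_add_smul T hf.le hu.1
    refine ⟨θ, hθ, ?_⟩
    nlinarith [hu.2])
  exact opNorm_le_numericalRadius T (mem_sphere_zero_iff_norm.1 hθ) hθT.ge

end NumericalIndex

/-! ### Consequences of the alternative Daugavet property: many vectors in one slice. -/

section AlternativeDaugavet

variable {𝕜 X : Type*} [RCLike 𝕜] [NormedAddCommGroup X] [NormedSpace 𝕜 X]

/-- Test the property on g/‖g‖ ⊗ z. A vector y nearly norming Id + θT has |g(y)| nearly ‖g‖, and w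
is a rotation of y. -/
theorem AlternativeDaugavetProperty.exists_norm_add_ge (h : AlternativeDaugavetProperty 𝕜 X)
    {z : X} (hz : z ≠ 0) (g : StrongDual 𝕜 X) {δ : ℝ} (hδ : 0 < δ) :
    ∃ w : X, ‖w‖ ≤ 1 ∧ ‖g‖ - δ ≤ ‖g w‖ ∧ ‖z‖ + 1 - δ ≤ ‖z + w‖ := by
  have hz0 : 0 < ‖z‖ := norm_pos_iff.2 hz
  rcases eq_or_ne g 0 with rfl | hg
  · refine ⟨((‖z‖⁻¹ : ℝ) : 𝕜) • z, ?_, by simp [hδ.le], ?_⟩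
    · rw [norm_smul, RCLike.norm_ofReal, abs_of_nonneg (by positivity), inv_mul_cancel₀ hz0.ne']
    · have : z + ((‖z‖⁻¹ : ℝ) : 𝕜) • z = ((1 + ‖z‖⁻¹ : ℝ) : 𝕜) • z := by
        rw [RCLike.ofReal_add, add_smul, RCLike.ofReal_one, one_smul]
      rw [this, norm_smul, RCLike.norm_ofReal, abs_of_nonneg (by positivity), add_mul,
        inv_mul_cancel₀ hz0.ne']
      linarith
  have hg0 : 0 < ‖g‖ := norm_pos_iff.2 hg
  set f : StrongDual 𝕜 X := ((‖g‖⁻¹ : ℝ) : 𝕜) • g with hfdef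
  have hf : ‖f‖ = 1 := by
    rw [hfdef, norm_smul, RCLike.norm_ofReal, abs_of_nonneg (by positivity),
      inv_mul_cancel₀ hg0.ne']
  have hf0 : f ≠ 0 := fun h0 => by simp [h0] at hf
  obtain ⟨⟨θ, hθ, hθT⟩, -⟩ := h f z hf0 hz
  rw [mem_sphere_zero_iff_norm] at hθ
  beta_reduce at hθT
  rw [ContinuousLinearMap.norm_smulRight_apply, hf, one_mul] at hθT
  -- The norm of z + w loses 2η, η ≤ ‖z‖/2 keeps c nonzero, and |g(w)| loses at most η‖g‖/‖z‖.
  set η := min (min (δ / 2) (‖z‖ / 2)) (δ * ‖z‖ / ‖g‖)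
  have hη : 0 < η := lt_min (lt_min (by positivity) (by positivity)) (by positivity)
  have hη1 : η ≤ δ / 2 := (min_le_left _ _).trans (min_le_left _ _)
  have hη2 : η ≤ ‖z‖ / 2 := (min_le_left _ _).trans (min_le_right _ _)
  have hη3 : η ≤ δ * ‖z‖ / ‖g‖ := min_le_right _ _
  rw [le_div_iff₀ hg0] at hη3
  obtain ⟨y, hy, hyT⟩ := ContinuousLinearMap.exists_lt_apply_of_lt_opNorm
    (ContinuousLinearMap.id 𝕜 X + θ • f.smulRight z) (r := 1 + ‖z‖ - η) (by linarith)
  set c := θ * f y with hc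
  have hyc : (ContinuousLinearMap.id 𝕜 X + θ • f.smulRight z) y = y + c • z := by
    simp [hc, smul_smul]
  rw [hyc] at hyT
  have hcf : ‖c‖ = ‖f y‖ := by rw [hc, norm_mul, hθ, one_mul]
  have hc1 : ‖c‖ ≤ 1 := by rw [hcf, ← hf]; exact f.unit_le_opNorm y hy.le
  have hcz : ‖z‖ - η ≤ ‖c‖ * ‖z‖ := by
    have := norm_add_le y (c • z)
    rw [norm_smul] at this
    linarith
  have hc0 : 0 < ‖c‖ := by
    by_contra! h0
    nlinarith
  set φ : 𝕜 := ((‖c‖⁻¹ : ℝ) : 𝕜) * c with hφdef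
  have hφ : ‖φ‖ = 1 := by
    rw [hφdef, norm_mul, RCLike.norm_ofReal, abs_of_nonneg (by positivity),
      inv_mul_cancel₀ hc0.ne']
  have hφ0 : φ ≠ 0 := fun h0 => by simp [h0] at hφ
  have hcφ : ‖c - φ‖ = 1 - ‖c‖ := by
    have h1 : c = ((‖c‖ : ℝ) : 𝕜) * φ := by
      rw [hφdef, ← mul_assoc, ← RCLike.ofReal_mul, mul_inv_cancel₀ hc0.ne', RCLike.ofReal_one,
        one_mul]
    have h2 : c - φ = ((‖c‖ - 1 : ℝ) : 𝕜) * φ := by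
      rw [RCLike.ofReal_sub, sub_mul, ← h1, RCLike.ofReal_one, one_mul]
    rw [h2, norm_mul, hφ, mul_one, RCLike.norm_ofReal, abs_of_nonpos (by linarith), neg_sub]
  refine ⟨φ⁻¹ • y, ?_, ?_, ?_⟩
  · rw [norm_smul, norm_inv, hφ, inv_one, one_mul]; exact hy.le
  · rw [map_smul, norm_smul, norm_inv, hφ, inv_one, one_mul]
    have h1 : ‖g y‖ = ‖g‖ * ‖c‖ := by
      rw [hcf, hfdef, smul_apply, norm_smul, RCLike.norm_ofReal,
        abs_of_nonneg (by positivity), ← mul_assoc, mul_inv_cancel₀ hg0.ne', one_mul]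
    rw [h1]
    have h2 : (‖g‖ - δ) * ‖z‖ ≤ (‖g‖ * ‖c‖) * ‖z‖ := by nlinarith
    exact le_of_mul_le_mul_right h2 hz0
  · have h1 : ‖z + φ⁻¹ • y‖ = ‖φ • z + y‖ := by
      rw [← one_mul ‖z + φ⁻¹ • y‖, ← hφ, ← norm_smul, smul_add, smul_smul, mul_inv_cancel₀ hφ0,
        one_smul]
    have h2 : y + c • z = (φ • z + y) + (c - φ) • z := by rw [sub_smul]; abel
    have h3 := norm_add_le (φ • z + y) ((c - φ) • z)
    rw [← h2, norm_smul, hcφ] at h3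
    rw [h1]
    linarith

theorem exists_functional_of_norm_sum_ge {x : X} {w : ℕ → X} {ε : ℝ} (hx : ‖x‖ ≤ 1)
    (hw : ∀ k, ‖w k‖ ≤ 1) (h : ∀ n : ℕ, 1 + n - ε ≤ ‖x + ∑ k ∈ Finset.range n, w k‖) :
    ∃ f : StrongDual 𝕜 X, ‖f‖ ≤ 1 ∧ 1 - ε ≤ RCLike.re (f x) ∧
      ∀ k, 1 - ε ≤ RCLike.re (f (w k)) := by
  let C : ℕ → Set (WeakDual 𝕜 X) := fun n =>
    (WeakDual.toStrongDual ⁻¹' Metric.closedBall (0 : StrongDual 𝕜 X) 1) ∩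
      ({f | 1 - ε ≤ RCLike.re (f x)} ∩ {f | ∀ k < n, 1 - ε ≤ RCLike.re (f (w k))})
  have hcl : ∀ n, IsClosed (C n) := by
    intro n
    have hre : ∀ v : X, IsClosed {f : WeakDual 𝕜 X | 1 - ε ≤ RCLike.re (f v)} := fun v =>
      isClosed_le continuous_const (RCLike.continuous_re.comp (WeakDual.eval_continuous v))
    refine (WeakDual.isClosed_closedBall 0 1).inter ((hre x).inter ?_)
    have : {f : WeakDual 𝕜 X | ∀ k < n, 1 - ε ≤ RCLike.re (f (w k))} =
        ⋂ k, ⋂ _ : k < n, {f : WeakDual 𝕜 X | 1 - ε ≤ RCLike.re (f (w k))} := by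
      ext; simp
    rw [this]
    exact isClosed_iInter fun k => isClosed_iInter fun _ => hre _
  have hne : ∀ n, (C n).Nonempty := by
    intro n
    -- A functional norming the sum has n + 1 real parts, each at most 1, with total at least n + 1
    -- - ε; so each is at least 1 - ε.
    obtain ⟨f, hf, hfz⟩ := exists_dual_vector'' 𝕜 (x + ∑ k ∈ Finset.range n, w k)
    have hle : ∀ v : X, ‖v‖ ≤ 1 → RCLike.re (f v) ≤ 1 := fun v hv =>
      (re_apply_le_opNorm hv).trans hf
    have hsum : 1 + n - ε ≤ RCLike.re (f x) + ∑ k ∈ Finset.range n, RCLike.re (f (w k)) := by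
      have := h n
      rw [← RCLike.ofReal_re (K := 𝕜) ‖x + ∑ k ∈ Finset.range n, w k‖, ← hfz] at this
      simpa using this
    refine ⟨StrongDual.toWeakDual f, by simpa using hf, ?_, fun k hk => ?_⟩
    · have : ∑ k ∈ Finset.range n, RCLike.re (f (w k)) ≤ n := by
        simpa using Finset.sum_le_card_nsmul (Finset.range n) (fun k => RCLike.re (f (w k))) 1
          fun k _ => hle _ (hw k)
      change 1 - ε ≤ RCLike.re (f x)
      linarith
    · have hk' := Finset.mem_range.2 hk
      have h1 : ∑ j ∈ (Finset.range n).erase k, RCLike.re (f (w j)) ≤ (n - 1 : ℝ) := by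
        have := Finset.sum_le_card_nsmul ((Finset.range n).erase k) (fun k => RCLike.re (f (w k))) 1
          fun k _ => hle _ (hw k)
        rw [Finset.card_erase_of_mem hk', Finset.card_range, nsmul_eq_mul, mul_one,
          Nat.cast_sub (by omega)] at this
        simpa using this
      have h2 := Finset.add_sum_erase (Finset.range n) (fun k => RCLike.re (f (w k))) hk'
      have h3 := hle x hx
      change 1 - ε ≤ RCLike.re (f (w k))
      linarith
  obtain ⟨f, hf⟩ := IsCompact.nonempty_iInter_of_sequence_nonempty_isCompact_isClosed C
    (fun n f hf => ⟨hf.1, hf.2.1, fun k hk => hf.2.2 k (hk.trans n.lt_succ_self)⟩) hne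
    ((WeakDual.isCompact_closedBall 0 1).of_isClosed_subset (hcl 0) Set.inter_subset_left) hcl
  rw [Set.mem_iInter] at hf
  exact ⟨WeakDual.toStrongDual f, by simpa using (hf 0).1, (hf 0).2.1,
    fun k => (hf (k + 1)).2.2 k k.lt_succ_self⟩

theorem AlternativeDaugavetProperty.exists_functional (h : AlternativeDaugavetProperty 𝕜 X)
    {x : X} (hx : ‖x‖ = 1) {ε : ℝ} (hε : 0 < ε) (hε1 : ε < 1) (g : ℕ → StrongDual 𝕜 X)
    {δ : ℕ → ℝ} (hδ : ∀ k, 0 < δ k) :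
    ∃ (f : StrongDual 𝕜 X) (w : ℕ → X), ‖f‖ ≤ 1 ∧ 1 - ε ≤ RCLike.re (f x) ∧
      ∀ k, ‖w k‖ ≤ 1 ∧ 1 - ε ≤ RCLike.re (f (w k)) ∧ ‖g k‖ - δ k ≤ ‖g k (w k)‖ := by
  -- The condition z ≠ 0 sits inside the existential so that `choose` yields a total function to
  -- iterate.
  have hstep : ∀ (k : ℕ) (z : X), ∃ w : X, z ≠ 0 →
      ‖w‖ ≤ 1 ∧ ‖g k‖ - δ k ≤ ‖g k w‖ ∧ ‖z‖ + 1 - ε * (1 / 2) ^ (k + 1) ≤ ‖z + w‖ := by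
    intro k z
    by_cases hz : z = 0
    · exact ⟨0, fun h0 => absurd hz h0⟩
    · obtain ⟨w, h1, h2, h3⟩ := h.exists_norm_add_ge hz (g k)
        (lt_min (hδ k) (show 0 < ε * (1 / 2) ^ (k + 1) by positivity))
      exact ⟨w, fun _ => ⟨h1, (sub_le_sub_left (min_le_left _ _) _).trans h2,
        (sub_le_sub_left (min_le_right _ _) _).trans h3⟩⟩
  choose W hW using hstep
  let z : ℕ → X := fun n => Nat.rec x (fun k v => v + W k v) n
  have hz0 : ∀ n : ℕ, 1 + n - ε ≤ ‖z n‖ → z n ≠ 0 := by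
    intro n hn h0
    rw [h0, norm_zero] at hn
    have : (0 : ℝ) ≤ n := n.cast_nonneg
    linarith
  -- The losses ε/2^(k+1), k < n, add up to ε(1 - 2^(-n)).
  have hz' : ∀ n : ℕ, 1 + n - ε * (1 - (1 / 2) ^ n) ≤ ‖z n‖ := by
    intro n
    induction n with
    | zero => simp [z, hx]
    | succ n ih =>
      have hp : (0 : ℝ) < (1 / 2) ^ n := by positivity
      have := (hW n (z n) (hz0 n (by nlinarith))).2.2
      change _ ≤ ‖z n + W n (z n)‖
      rw [pow_succ] at this ⊢
      push_cast
      linarith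
  have hz : ∀ n : ℕ, 1 + n - ε ≤ ‖z n‖ := by
    intro n
    have hp : (0 : ℝ) < (1 / 2) ^ n := by positivity
    nlinarith [hz' n]
  have hsum : ∀ n, z n = x + ∑ k ∈ Finset.range n, W k (z k) := by
    intro n
    induction n with
    | zero => simp [z]
    | succ n ih =>
      rw [Finset.sum_range_succ, ← add_assoc, ← ih]
  have hWz := fun k => hW k (z k) (hz0 k (hz k))
  obtain ⟨f, hf, hfx, hfw⟩ := exists_functional_of_norm_sum_ge (𝕜 := 𝕜) hx.le
    (fun k => (hWz k).1) (fun n => (hsum n ▸ hz n))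
  exact ⟨f, fun k => W k (z k), hf, hfx, fun k => ⟨(hWz k).1, hfw k, (hWz k).2.1⟩⟩

end AlternativeDaugavet

/-! ### Bases: from coordinate functionals to the whole unit ball. -/

section Unconditional

variable {𝕜 X ι : Type*} [RCLike 𝕜] [NormedAddCommGroup X] [NormedSpace 𝕜 X]

theorem tendsto_proj_atTop (b : UnconditionalSchauderBasis ι 𝕜 X) (x : X) :
    Filter.Tendsto (fun A => b.proj A x) Filter.atTop (nhds x) := by
  simpa using! b.tendsto_proj x

/-- The reflection `2 P_A - Id` is an isometry. -/
theorem IsOneUnconditional.norm_two_smul_proj_sub {b : UnconditionalSchauderBasis ι 𝕜 X}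
    (hb : IsOneUnconditional b) (A : Finset ι) (x : X) : ‖(2 : 𝕜) • b.proj A x - x‖ = ‖x‖ := by
  classical
  have h1 : Filter.Tendsto (fun G => ‖(2 : 𝕜) • b.proj A x - b.proj G x‖) Filter.atTop
      (nhds ‖(2 : 𝕜) • b.proj A x - x‖) := ((tendsto_proj_atTop b x).const_sub _).norm
  have h2 : Filter.Tendsto (fun G => ‖b.proj G x‖) Filter.atTop (nhds ‖x‖) :=
    (tendsto_proj_atTop b x).norm
  refine tendsto_nhds_unique (h1.congr' ?_) h2
  filter_upwards [Filter.eventually_ge_atTop A] with G hG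
  -- For G ⊇ A, 2P_A x - P_G x is P_G x with the signs off A reversed.
  have := hb G (fun i => b.coord i x) (fun i => if i ∈ A then 1 else -1)
    (fun i => by by_cases hi : i ∈ A <;> simp [hi])
  rw [b.proj_apply G, ← this]
  congr 1
  rw [b.proj_apply, ← Finset.sum_sdiff hG, ← Finset.sum_sdiff hG]
  have e1 : ∑ i ∈ A, ((if i ∈ A then (1 : 𝕜) else -1) * b.coord i x) • b i =
      ∑ i ∈ A, b.coord i x • b i :=
    Finset.sum_congr rfl fun i hi => by rw [if_pos hi, one_mul]
  have e2 : ∑ i ∈ G \ A, ((if i ∈ A then (1 : 𝕜) else -1) * b.coord i x) • b i =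
      -∑ i ∈ G \ A, b.coord i x • b i := by
    rw [← Finset.sum_neg_distrib]
    exact Finset.sum_congr rfl fun i hi => by
      rw [if_neg (Finset.mem_sdiff.1 hi).2, neg_one_mul, neg_smul]
  rw [e1, e2, two_smul]
  abel

theorem comp_proj_mem_span_coord (b : UnconditionalSchauderBasis ι 𝕜 X) (A : Finset ι)
    (f : StrongDual 𝕜 X) : f.comp (b.proj A) ∈ Submodule.span 𝕜 (Set.range b.coord) := by
  have : f.comp (b.proj A) = ∑ i ∈ A, f (b i) • b.coord i := by
    ext x
    simp [mul_comm]
  rw [this]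
  exact Submodule.sum_mem _ fun i _ => Submodule.smul_mem _ _ (Submodule.subset_span ⟨i, rfl⟩)

theorem exists_seq_dense_comp_proj [Countable ι] (b : UnconditionalSchauderBasis ι 𝕜 X) :
    ∃ g : ℕ → StrongDual 𝕜 X, ∀ (A : Finset ι) (f : StrongDual 𝕜 X) (δ : ℝ), 0 < δ →
      ∃ n, ‖f.comp (b.proj A) - g n‖ < δ := by
  obtain ⟨c, hc, hcl⟩ := (Set.countable_range b.coord).isSeparable.span (R := 𝕜)
  have hne : c.Nonempty := by
    rw [← closure_nonempty_iff]
    exact ⟨0, hcl (Submodule.zero_mem _)⟩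
  obtain ⟨g, rfl⟩ := hc.exists_eq_range hne
  refine ⟨g, fun A f δ hδ => ?_⟩
  obtain ⟨_, ⟨n, rfl⟩, hn⟩ :=
    Metric.mem_closure_iff.1 (hcl (comp_proj_mem_span_coord b A f)) δ hδ
  exact ⟨n, by rwa [← dist_eq_norm]⟩

variable [NormedSpace ℝ X] [IsScalarTower ℝ 𝕜 X]

/-- A closed convex set on which the coordinate functionals of finite support attain (almost) their
norm contains the unit ball. -/
theorem IsOneUnconditional.closedBall_subset_of_isClosed_of_convex
    {b : UnconditionalSchauderBasis ι 𝕜 X} (hb : IsOneUnconditional b) {K : Set X}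
    (hK : IsClosed K) (hKc : Convex ℝ K) (hK1 : ∀ a ∈ K, ‖a‖ ≤ 1)
    (h : ∀ (A : Finset ι) (f : StrongDual 𝕜 X) (δ : ℝ), 0 < δ →
      ∃ a ∈ K, ‖f.comp (b.proj A)‖ - δ ≤ RCLike.re (f (b.proj A a))) :
    Metric.closedBall (0 : X) 1 ⊆ K := by
  intro y hy
  rw [mem_closedBall_zero_iff] at hy
  by_contra hyK
  obtain ⟨f, u, hfK, huy⟩ := RCLike.geometric_hahn_banach_closed_point (𝕜 := 𝕜) hKc hK hyK
  have huf : u < ‖f‖ := huy.trans_le (re_apply_le_opNorm hy)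
  set η := (‖f‖ - u) / 4 with hη
  have hη0 : 0 < η := by rw [hη]; linarith
  obtain ⟨x, hx, hfx⟩ := exists_lt_re_apply_of_lt_opNorm f (sub_lt_self ‖f‖ hη0)
  have hlim : Filter.Tendsto (fun A => RCLike.re (f (b.proj A x))) Filter.atTop
      (nhds (RCLike.re (f x))) :=
    ((RCLike.continuous_re.comp f.continuous).tendsto x).comp (tendsto_proj_atTop b x)
  obtain ⟨A, hA⟩ := (hlim.eventually_const_lt hfx).exists
  -- A functional k separating P_A x from P_A K would contradict that K nearly attains ‖k ∘ P_A‖.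
  have hmem : b.proj A x ∈ closure (b.proj A '' K) := by
    by_contra hx'
    have hconv : Convex ℝ (b.proj A '' K) :=
      hKc.linear_image ((b.proj A).restrictScalars ℝ).toLinearMap
    obtain ⟨k, v, hkK, hvx⟩ := RCLike.geometric_hahn_banach_closed_point (𝕜 := 𝕜)
      hconv.closure isClosed_closure hx'
    have hvk : v < ‖k.comp (b.proj A)‖ :=
      hvx.trans_le (re_apply_le_opNorm (f := k.comp (b.proj A)) hx)
    obtain ⟨a, ha, hka⟩ := h A k _ (sub_pos.2 hvk)
    have := hkK _ (subset_closure ⟨a, ha, rfl⟩)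
    linarith
  have hopen : IsOpen {z : X | ‖f‖ - η < RCLike.re (f z)} :=
    isOpen_lt continuous_const (RCLike.continuous_re.comp f.continuous)
  obtain ⟨_, hfa, a, ha, rfl⟩ := mem_closure_iff.1 hmem _ hopen hA
  -- The reflection of a lies in the unit ball, so Re f(a) ≥ 2 Re f(P_A a) - ‖f‖ > ‖f‖ - 2η > u.
  have h1 : RCLike.re (f ((2 : 𝕜) • b.proj A a - a)) ≤ ‖f‖ :=
    re_apply_le_opNorm ((hb.norm_two_smul_proj_sub A a).le.trans (hK1 a ha))
  rw [map_sub, map_sub, two_smul, map_add, map_add] at h1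
  have h2 := hfK a ha
  change ‖f‖ - η < RCLike.re (f (b.proj A a)) at hfa
  linarith

theorem AlternativeDaugavetProperty.isLush [Countable ι] (h : AlternativeDaugavetProperty 𝕜 X)
    {b : UnconditionalSchauderBasis ι 𝕜 X} (hb : IsOneUnconditional b) : IsLush 𝕜 X := by
  intro x y hx hy ε hε
  set ε' := min ε 1 / 2 with hε'
  have h0 : 0 < ε' := by rw [hε']; positivity
  have h1 : ε' < 1 := by rw [hε']; linarith [min_le_right ε 1]
  have h2 : ε' < ε := by rw [hε']; linarith [min_le_left ε 1, lt_min hε one_pos]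
  obtain ⟨g, hg⟩ := exists_seq_dense_comp_proj b
  -- Unpairing k makes each functional of the dense sequence recur with every tolerance 1/(m + 1).
  obtain ⟨f₀, w, hf₀, hfx, hw⟩ := h.exists_functional hx h0 h1 (fun k => g k.unpair.1)
    (δ := fun k => 1 / ((k.unpair.2 : ℝ) + 1)) (fun k => by positivity)
  have hpos : 0 < ‖f₀‖ := by
    have := re_apply_le_opNorm (f := f₀) hx.le
    linarith
  set f : StrongDual 𝕜 X := ((‖f₀‖⁻¹ : ℝ) : 𝕜) • f₀ with hfdef
  have hf : ‖f‖ = 1 := by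
    rw [hfdef, norm_smul, RCLike.norm_ofReal, abs_of_nonneg (by positivity),
      inv_mul_cancel₀ hpos.ne']
  have hmem : ∀ v : X, ‖v‖ ≤ 1 → 1 - ε' ≤ RCLike.re (f₀ v) →
      v ∈ slice (Metric.closedBall (0 : X) 1) f ε := by
    intro v hv hfv
    refine mem_slice_closedBall.2 ⟨hv, ?_⟩
    rw [hf, hfdef, smul_apply, smul_eq_mul, RCLike.re_ofReal_mul]
    -- Normalising f₀ only increases the positive number Re f₀(v).
    have : 1 ≤ ‖f₀‖⁻¹ := (one_le_inv₀ hpos).2 hf₀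
    nlinarith
  refine ⟨f, hf, hmem x hx.le hfx, ?_⟩
  suffices hsub : Metric.closedBall (0 : X) 1 ⊆
      closedAconv 𝕜 (slice (Metric.closedBall (0 : X) 1) f ε) by
    rwa [Metric.infDist_zero_of_mem (hsub (mem_closedBall_zero_iff.2 hy.le))]
  refine hb.closedBall_subset_of_isClosed_of_convex isClosed_closedConvexHull
    convex_closedConvexHull ?_ ?_
  · intro a ha
    have : closedAconv 𝕜 (slice (Metric.closedBall (0 : X) 1) f ε) ⊆
        Metric.closedBall (0 : X) 1 := by
      refine closedConvexHull_min ?_ (convex_closedBall _ _) Metric.isClosed_closedBall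
      intro v hv
      obtain ⟨θ, hθ, z, hz, rfl⟩ := Set.mem_smul.1 hv
      rw [mem_closedBall_zero_iff, norm_smul, mem_sphere_zero_iff_norm.1 hθ, one_mul]
      exact mem_closedBall_zero_iff.1 hz.1
    exact mem_closedBall_zero_iff.1 (this ha)
  · intro A k δ hδ
    -- Replacing k ∘ P_A by g n costs δ/3 twice, in the norm and at v; the tolerance 1/(m + 1) costs
    -- the last third.
    obtain ⟨n, hn⟩ := hg A k (δ / 3) (by positivity)
    obtain ⟨m, hm⟩ := exists_nat_one_div_lt (show 0 < δ / 3 by positivity)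
    obtain ⟨hw1, hw2, hw3⟩ := hw (Nat.pair n m)
    simp only [Nat.unpair_pair] at hw3
    set v := w (Nat.pair n m)
    obtain ⟨c, hc, hcv⟩ := RCLike.exists_norm_eq_mul_self (k (b.proj A v))
    refine ⟨c • v, subset_closedConvexHull
      (Set.smul_mem_smul (mem_sphere_zero_iff_norm.2 hc) (hmem v hw1 hw2)), ?_⟩
    rw [map_smul, map_smul, smul_eq_mul, ← hcv, RCLike.ofReal_re]
    have e1 : ‖k.comp (b.proj A)‖ ≤ ‖k.comp (b.proj A) - g n‖ + ‖g n‖ := by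
      simpa using norm_add_le (k.comp (b.proj A) - g n) (g n)
    have e2 : ‖g n v‖ ≤ ‖k (b.proj A v)‖ + ‖k.comp (b.proj A) - g n‖ := by
      have e3 := (k.comp (b.proj A) - g n).unit_le_opNorm v hw1
      have e4 : g n v = k (b.proj A v) - (k.comp (b.proj A) - g n) v := by simp
      rw [e4]
      exact (norm_sub_le _ _).trans (by gcongr)
    linarith

end Unconditional

/-- Let `X` be a real or complex Banach space with a countable `1`-unconditional basis. Then the
alternative Daugavet property, lushness and numerical index `1` are equivalent for `X`. -/
theorem mainTheorem5 {𝕜 X ι : Type*} [RCLike 𝕜] [NormedAddCommGroup X] [NormedSpace 𝕜 X]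
    [NormedSpace ℝ X] [IsScalarTower ℝ 𝕜 X] [CompleteSpace X] [Countable ι]
    (b : UnconditionalSchauderBasis ι 𝕜 X) (hb : IsOneUnconditional b) :
    List.TFAE [AlternativeDaugavetProperty 𝕜 X, IsLush 𝕜 X, HasNumericalIndexOne 𝕜 X] := by
  tfae_have 1 → 2 := fun h => h.isLush hb
  tfae_have 2 → 3 := fun h => h.hasNumericalIndexOne
  tfae_have 3 → 1 := fun h => h.alternativeDaugavetProperty
  tfae_finish
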